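/- **Forests.** Let $D$ be a set. A $D$-decorated aromatic forest is a finite directed graph $\pi$ in which every vertex has at most one outgoing edge (loops are allowed) and which is empty or has at least one root (a vertex without outgoing edge), together with a map $V(\pi)\to D$; isomorphic ones are identified. A grafted forest is an aromatic forest decorated by $\{\bullet,\times\}$ in which no edge ends in a vertex decorated by $\times$. An exotic forest is a grafted forest together with a partition of the set of its $\times$-vertices into pairs; isomorphisms preserve the pairing. Let $\mathcal F$ be one of the following classes: the set $AF_D$ of $D$-decorated aromatic forests (for an arbitrary set $D$), the set $AF_g$ of grafted forests, the set $EF$ of exotic forests. Let $\mathrm{span}\,\mathcal F$ be the real vector space with basis $\mathcal F$ (this is $\mathcal{AF}_D$, $\mathcal{AF}_g$, $\mathcal{EF}$ respectively), let $\mathbf 1\in\mathcal F$ be the empty forest, and let $\sigma(\pi)$ be the number of automorphisms of $\pi\in\mathcal F$. **Products.** For $\pi_1,\pi_2\in\mathcal F$ let $\pi_1\curvearrowright\pi_2$ be the sum, over all maps $f$ from the roots of $\pi_1$ to the vertices of $\pi_2$, of the graphs obtained from the disjoint union of $\pi_1$ and $\pi_2$ by adding an edge from $r$ to $f(r)$ for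 every root $r$ of $\pi_1$; let the Grossman--Larson product $\pi_1\diamond\pi_2$ be the same sum over all ways to attach each root of $\pi_1$ to a vertex of $\pi_2$ or to leave it a root. In both sums graphs which are not in $\mathcal F$ count as $0$ (this concerns only edges into $\times$-vertices). The Connes--Kreimer coproduct is $$\Delta_{CK}(\pi)=\sum_{\pi_0\subset\pi}(\pi\setminus\pi_0)\otimes\pi_0 ,$$ the sum being over all sets $\pi_0$ of vertices of $\pi$ such that no edge of $\pi$ goes from $\pi_0$ to $\pi\setminus\pi_0$, and such that $\pi_0$ and $\pi\setminus\pi_0$, with the induced edges, decorations and pairing, belong to $\mathcal F$ (so each of them is empty or has a root and, in the exotic case, no pair is split). The product $\circledast$ is its dual: the coefficient of $\pi$ in $\pi_1\circledast\pi_2$ is the coefficient of $\pi_1\otimes\pi_2$ in $\Delta_{CK}(\pi)$. The operations $\curvearrowright$, $\diamond$, $\circledast$ are extended bilinearly to $\mathrm{span}\,\mathcal F$. **Proposition.** For each of these classes, $x\curvearrowright(y\curvearrowright z)=(x\diamond y)\curvearrowright z$ for all $x,y,z\in\mathrm{span}\,\mathcal F$; $(\mathrm{span}\,\mathcal F,\diamond,\mathbf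 1)$ and $(\mathrm{span}\,\mathcal F,\circledast,\mathbf 1)$ are associative unital algebras; and the linear map $A_\sigma$ with $A_\sigma(\pi)=\sigma(\pi)\,\pi$ for $\pi\in\mathcal F$ is an isomorphism of unital algebras $$A_\sigma:(\mathrm{span}\,\mathcal F,\diamond)\longrightarrow(\mathrm{span}\,\mathcal F,\circledast).$$ In particular this holds for $\mathcal{AF}_D$ with any set $D$, for $\mathcal{AF}_g$ and for $\mathcal{EF}$. -/

import Mathlib

open scoped TensorProduct

universe u

namespace AromaticForest

/-- A finite directed graph in which every vertex has at most one outgoing edge (`next v = some w`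
is the edge from `v` to `w`, loops allowed; `next v = none` says that `v` is a root), with
decorations of the vertices in `D`, and with an involution `mate` of the vertices. Two distinct
vertices exchanged by `mate` are paired (a liana); a graph without pairing has `mate = id`. -/
structure Graph (D : Type u) where
  V : Type
  [fintypeV : Fintype V]
  next : V → Option V
  dec : V → D
  mate : V → V
  mate_mate : ∀ v, mate (mate v) = v

attribute [instance] Graph.fintypeV

/-- Isomorphisms: bijections of the vertices which preserve edges, decorations and pairing. -/
structure Iso {D : Type u} (G H : Graph D) where
  toEquiv : G.V ≃ H.V
  next_eq : ∀ v, H.next (toEquiv v) = (G.next v).map toEquiv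
  dec_eq : ∀ v, H.dec (toEquiv v) = G.dec v
  mate_eq : ∀ v, H.mate (toEquiv v) = toEquiv (G.mate v)

namespace Iso

variable {D : Type u} {G H K : Graph D}

def refl (G : Graph D) : Iso G G where
  toEquiv := Equiv.refl _
  next_eq v := by simp
  dec_eq v := rfl
  mate_eq v := rfl

def symm (e : Iso G H) : Iso H G where
  toEquiv := e.toEquiv.symm
  next_eq v := by
    have h := e.next_eq (e.toEquiv.symm v)
    rw [Equiv.apply_symm_apply] at h
    rw [h, Option.map_map]
    simp
  dec_eq v := by
    have h := e.dec_eq (e.toEquiv.symm v)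
    rw [Equiv.apply_symm_apply] at h
    exact h.symm
  mate_eq v := by
    have h := e.mate_eq (e.toEquiv.symm v)
    rw [Equiv.apply_symm_apply] at h
    rw [h, Equiv.symm_apply_apply]

def trans (e : Iso G H) (f : Iso H K) : Iso G K where
  toEquiv := e.toEquiv.trans f.toEquiv
  next_eq v := by simp [f.next_eq, e.next_eq, Option.map_map]
  dec_eq v := by simp [f.dec_eq, e.dec_eq]
  mate_eq v := by simp [f.mate_eq, e.mate_eq]

@[ext]
theorem ext' {e f : Iso G H} (h : ∀ v, e.toEquiv v = f.toEquiv v) : e = f := by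
  have : e.toEquiv = f.toEquiv := Equiv.ext h
  cases e; cases f; cases this; rfl

end Iso

namespace Graph

variable {D : Type u}

/-- A nonempty forest must have at least one root. -/
def IsRooted (G : Graph D) : Prop := IsEmpty G.V ∨ ∃ v, G.next v = none

/-- The set of roots. -/
abbrev Root (G : Graph D) : Type := {v : G.V // G.next v = none}

noncomputable instance (G : Graph D) : Fintype G.Root := by
  classical exact Subtype.fintype _

/-- The empty forest. -/
def empty (D : Type u) : Graph D where
  V := Empty
  next v := v.elim
  dec v := v.elim
  mate v := v
  mate_mate _ := rfl

open Classical in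
/-- The graph obtained from the disjoint union of `G` and `H` by adding, for every root `r` of `G`
with `f r = some w`, an edge from `r` to the vertex `w` of `H`; the roots with `f r = none` remain
roots. -/
noncomputable abbrev attach (G H : Graph D) (f : G.Root → Option H.V) : Graph D where
  V := G.V ⊕ H.V
  next := Sum.elim
    (fun v => if h : G.next v = none then (f ⟨v, h⟩).map Sum.inr else (G.next v).map Sum.inl)
    (fun w => (H.next w).map Sum.inr)
  dec := Sum.elim G.dec H.dec
  mate := Sum.map G.mate H.mate
  mate_mate v := by cases v <;> simp [G.mate_mate, H.mate_mate]

open Classical in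
/-- The induced graph on a set of vertices. A pair with only one vertex in `S` is dissolved. -/
noncomputable abbrev restrict (G : Graph D) (S : Set G.V) : Graph D where
  V := {v : G.V // v ∈ S}
  next v := (G.next v.1).bind fun w => if h : w ∈ S then some ⟨w, h⟩ else none
  dec v := G.dec v.1
  mate v := if h : G.mate v.1 ∈ S then ⟨G.mate v.1, h⟩ else v
  mate_mate v := by
    by_cases h : G.mate v.1 ∈ S
    · simp [h, G.mate_mate]
    · simp [h]

/-- No edge goes from a vertex of `S` to a vertex outside `S`. -/
def IsClosed (G : Graph D) (S : Set G.V) : Prop :=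
  ∀ v ∈ S, ∀ w, G.next v = some w → w ∈ S

/-- The order of the automorphism group. -/
noncomputable def sigma (G : Graph D) : ℕ := Nat.card (Iso G G)

end Graph

/-- A class of forests, closed under isomorphism. -/
structure ForestClass (D : Type u) where
  Mem : Graph D → Prop
  mem_of_iso : ∀ {G H : Graph D}, Iso G H → Mem G → Mem H

section IsoLemmas

variable {D : Type u} {G G' H H' : Graph D}

theorem Iso.isRooted (e : Iso G H) (h : G.IsRooted) : H.IsRooted := by
  rcases h with h | ⟨v, hv⟩
  · exact Or.inl (e.toEquiv.symm.isEmpty)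
  · exact Or.inr ⟨e.toEquiv v, by rw [e.next_eq, hv]; rfl⟩

/-- An isomorphism maps roots to roots. -/
def Iso.root (e : Iso G H) : G.Root ≃ H.Root :=
  e.toEquiv.subtypeEquiv fun v => by rw [e.next_eq]; simp

theorem Iso.next_symm (e : Iso G H) (w : H.V) :
    G.next (e.toEquiv.symm w) = (H.next w).map e.toEquiv.symm := e.symm.next_eq w

def Iso.attach (e : Iso G G') (e' : Iso H H') (f : G.Root → Option H.V)
    (f' : G'.Root → Option H'.V) (hf : ∀ r, f' (e.root r) = (f r).map e'.toEquiv) :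
    Iso (G.attach H f) (G'.attach H' f') where
  toEquiv := Equiv.sumCongr e.toEquiv e'.toEquiv
  next_eq := by
    rintro (v | v)
    · by_cases h : G.next v = none
      · have h' : G'.next (e.toEquiv v) = none := by rw [e.next_eq, h]; rfl
        have h₁ : (G'.attach H' f').next (Sum.inl (e.toEquiv v)) =
            (f' (e.root ⟨v, h⟩)).map Sum.inr := dif_pos h'
        have h₂ : (G.attach H f).next (Sum.inl v) = (f ⟨v, h⟩).map Sum.inr := dif_pos h
        refine h₁.trans ?_
        rw [h₂, hf, Option.map_map, Option.map_map]
        rfl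
      · have h' : G'.next (e.toEquiv v) ≠ none := by rw [e.next_eq]; simpa using h
        have h₁ : (G'.attach H' f').next (Sum.inl (e.toEquiv v)) =
            (G'.next (e.toEquiv v)).map Sum.inl := dif_neg h'
        have h₂ : (G.attach H f).next (Sum.inl v) = (G.next v).map Sum.inl := dif_neg h
        refine h₁.trans ?_
        rw [h₂, e.next_eq, Option.map_map, Option.map_map]
        rfl
    · change (H'.next (e'.toEquiv v)).map Sum.inr = ((H.next v).map Sum.inr).map _
      rw [e'.next_eq, Option.map_map, Option.map_map]
      rfl
  dec_eq := by
    rintro (v | v)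
    · exact e.dec_eq v
    · exact e'.dec_eq v
  mate_eq := by
    rintro (v | v)
    · exact congrArg Sum.inl (e.mate_eq v)
    · exact congrArg Sum.inr (e'.mate_eq v)

def Iso.restrict (e : Iso G H) (S : Set G.V) (T : Set H.V) (h : ∀ v, v ∈ S ↔ e.toEquiv v ∈ T) :
    Iso (G.restrict S) (H.restrict T) where
  toEquiv := e.toEquiv.subtypeEquiv h
  next_eq := by
    classical
    rintro ⟨v, hv⟩
    change (H.next (e.toEquiv v)).bind
        (fun w => if h : w ∈ T then some (⟨w, h⟩ : {v // v ∈ T}) else none) =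
      Option.map (e.toEquiv.subtypeEquiv h)
        ((G.next v).bind fun w => if h : w ∈ S then some (⟨w, h⟩ : {v // v ∈ S}) else none)
    rw [e.next_eq]
    cases hn : G.next v with
    | none => rfl
    | some w =>
      by_cases hw : w ∈ S
      · have := (h w).1 hw
        simp [hw, this]
      · have : e.toEquiv w ∉ T := fun h' => hw ((h w).2 h')
        simp [hw, this]
  dec_eq v := e.dec_eq v.1
  mate_eq := by
    classical
    rintro ⟨v, hv⟩
    change (if h' : H.mate (e.toEquiv v) ∈ T then (⟨H.mate (e.toEquiv v), h'⟩ : {v // v ∈ T})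
        else ⟨e.toEquiv v, (h v).1 hv⟩) =
      e.toEquiv.subtypeEquiv h (if h' : G.mate v ∈ S then ⟨G.mate v, h'⟩ else ⟨v, hv⟩)
    by_cases hm : G.mate v ∈ S
    · have hm' : H.mate (e.toEquiv v) ∈ T := by rw [e.mate_eq]; exact (h _).1 hm
      rw [dif_pos hm, dif_pos hm']
      exact Subtype.ext (e.mate_eq v)
    · have hm' : H.mate (e.toEquiv v) ∉ T := by
        rw [e.mate_eq]; exact fun h' => hm ((h _).2 h')
      rw [dif_neg hm, dif_neg hm']
      rfl

theorem Iso.isClosed (e : Iso G H) (S : Set G.V) (T : Set H.V)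
    (h : ∀ v, v ∈ S ↔ e.toEquiv v ∈ T) (hS : G.IsClosed S) : H.IsClosed T := by
  intro v hv w hw
  obtain ⟨v, rfl⟩ := e.toEquiv.surjective v
  rw [e.next_eq, Option.map_eq_some_iff] at hw
  obtain ⟨a, ha, rfl⟩ := hw
  exact (h a).1 (hS v ((h v).2 hv) a ha)

theorem Iso.sigma_eq (e : Iso G H) : G.sigma = H.sigma :=
  Nat.card_congr
    { toFun := fun f => (e.symm.trans f).trans e
      invFun := fun f => (e.trans f).trans e.symm
      left_inv := fun f => by ext v; simp [Iso.trans, Iso.symm]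
      right_inv := fun f => by ext v; simp [Iso.trans, Iso.symm] }

end IsoLemmas

/-- Aromatic forests decorated by `D`: no pairing, and at least one root unless empty. -/
def aromatic (D : Type u) : ForestClass D where
  Mem G := G.IsRooted ∧ ∀ v, G.mate v = v
  mem_of_iso := by
    rintro G H e ⟨h, h'⟩
    refine ⟨e.isRooted h, fun v => ?_⟩
    obtain ⟨v, rfl⟩ := e.toEquiv.surjective v
    rw [e.mate_eq, h']

/-- The two colours: black vertices and grafted vertices (crosses). -/
inductive Color : Type
  | black : Color
  | cross : Color

/-- The grafted vertices are leaves. -/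
def Graph.CrossesAreLeaves (G : Graph Color) : Prop :=
  ∀ v u, G.next v = some u → G.dec u = Color.black

theorem Iso.crossesAreLeaves {G H : Graph Color} (e : Iso G H) (h : G.CrossesAreLeaves) :
    H.CrossesAreLeaves := by
  intro v u hu
  obtain ⟨v, rfl⟩ := e.toEquiv.surjective v
  rw [e.next_eq, Option.map_eq_some_iff] at hu
  obtain ⟨a, ha, rfl⟩ := hu
  rw [e.dec_eq]
  exact h v a ha

/-- Grafted forests: aromatic forests with black and grafted vertices, in which the grafted vertices
are leaves. -/
def grafted : ForestClass Color where
  Mem G := G.IsRooted ∧ (∀ v, G.mate v = v) ∧ G.CrossesAreLeaves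
  mem_of_iso := by
    rintro G H e ⟨h, h', h''⟩
    refine ⟨e.isRooted h, fun v => ?_, e.crossesAreLeaves h''⟩
    obtain ⟨v, rfl⟩ := e.toEquiv.surjective v
    rw [e.mate_eq, h']

/-- Exotic forests: grafted forests together with a partition of the set of grafted vertices into
pairs. -/
def exotic : ForestClass Color where
  Mem G := G.IsRooted ∧ (∀ v, G.mate v = v ↔ G.dec v = Color.black) ∧ G.CrossesAreLeaves
  mem_of_iso := by
    rintro G H e ⟨h, h', h''⟩
    refine ⟨e.isRooted h, fun v => ?_, e.crossesAreLeaves h''⟩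
    obtain ⟨v, rfl⟩ := e.toEquiv.surjective v
    rw [e.mate_eq, e.dec_eq, ← h', e.toEquiv.apply_eq_iff_eq]

namespace ForestClass

variable {D : Type u} (C : ForestClass D)

@[reducible] def setoid : Setoid {G : Graph D // C.Mem G} where
  r G H := Nonempty (Iso G.1 H.1)
  iseqv :=
    { refl := fun _ => ⟨Iso.refl _⟩
      symm := fun ⟨e⟩ => ⟨e.symm⟩
      trans := fun ⟨e⟩ ⟨f⟩ => ⟨e.trans f⟩ }

/-- The set of forests of the class, isomorphic forests being identified. -/
def Forest : Type (max 1 u) := Quotient C.setoid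

def toForest (G : Graph D) (h : C.Mem G) : C.Forest := Quotient.mk C.setoid ⟨G, h⟩

/-- The real vector space with the forests of the class as basis. -/
abbrev Space : Type (max 1 u) := C.Forest →₀ ℝ

open Classical in
/-- The basis vector of a forest of the class; `0` for every other graph. -/
noncomputable def vec (G : Graph D) : C.Space :=
  if h : C.Mem G then Finsupp.single (C.toForest G h) 1 else 0

theorem vec_eq_of_iso {G H : Graph D} (e : Iso G H) : C.vec G = C.vec H := by
  by_cases h : C.Mem G
  · have h' := C.mem_of_iso e h
    have : C.toForest G h = C.toForest H h' := Quotient.sound ⟨e⟩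
    simp [vec, h, h', this]
  · have h' : ¬ C.Mem H := fun h' => h (C.mem_of_iso e.symm h')
    simp [vec, h, h']

/-- The symmetry coefficient of a forest. -/
noncomputable def sigma : C.Forest → ℕ :=
  Quotient.lift (fun G => G.1.sigma) fun _ _ ⟨e⟩ => e.sigma_eq

/-- The linear map which multiplies every forest by its symmetry coefficient. -/
noncomputable def Asigma : C.Space →ₗ[ℝ] C.Space :=
  Finsupp.linearCombination ℝ fun π => (C.sigma π : ℝ) • Finsupp.single π (1 : ℝ)

/-- The empty forest, as a vector. -/
noncomputable def one : C.Space := C.vec (Graph.empty D)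

open Classical in
/-- Grafting of forests: every root of the first forest gets an edge to some vertex of the second
forest, in all possible ways. -/
noncomputable def graftForest (π₁ π₂ : C.Forest) : C.Space :=
  Quotient.lift₂
    (fun G H => ∑ f : G.1.Root → H.1.V, C.vec (G.1.attach H.1 fun r => some (f r)))
    (by
      rintro G H G' H' ⟨e⟩ ⟨e'⟩
      refine Fintype.sum_equiv (Equiv.arrowCongr e.root e'.toEquiv) _ _ fun f => ?_
      refine C.vec_eq_of_iso (Iso.attach e e' _ _ fun r => ?_)
      simp [Equiv.arrowCongr]) π₁ π₂

open Classical in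
/-- The Grossman-Larson product of two forests: every root of the first forest either gets an edge
to some vertex of the second forest or remains a root, in all possible ways. -/
noncomputable def glForest (π₁ π₂ : C.Forest) : C.Space :=
  Quotient.lift₂
    (fun G H => ∑ f : G.1.Root → Option H.1.V, C.vec (G.1.attach H.1 f))
    (by
      rintro G H G' H' ⟨e⟩ ⟨e'⟩
      refine Fintype.sum_equiv (Equiv.arrowCongr e.root (Equiv.optionCongr e'.toEquiv)) _ _
        fun f => ?_
      refine C.vec_eq_of_iso (Iso.attach e e' _ _ fun r => ?_)
      simp [Equiv.arrowCongr]) π₁ π₂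

open Classical in
/-- The Connes-Kreimer coproduct of a forest: the sum of `(π ∖ π₀) ⊗ π₀` over all subsets `π₀` of
the vertices such that no edge goes from `π₀` to `π ∖ π₀` and both parts, with the induced
structure, are again forests of the class (other terms vanish by the definition of `vec`; in
particular each part is empty or has a root, and no pair is split between the parts). -/
noncomputable def coprodForest : C.Forest → C.Space ⊗[ℝ] C.Space :=
  Quotient.lift
    (fun G => ∑ S : {S : Set G.1.V // G.1.IsClosed S},
      C.vec (G.1.restrict S.1ᶜ) ⊗ₜ[ℝ] C.vec (G.1.restrict S.1))
    (by
      rintro G H ⟨e⟩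
      have key : ∀ (S : Set G.1.V) (v : G.1.V), v ∈ S ↔ e.toEquiv v ∈ e.toEquiv '' S :=
        fun S v => (e.toEquiv.injective.mem_set_image).symm
      refine Fintype.sum_equiv
        ((Equiv.Set.congr e.toEquiv).subtypeEquiv fun S => ⟨?_, ?_⟩) _ _ fun S => ?_
      · exact e.isClosed S _ (key S)
      · refine e.symm.isClosed _ S fun v => ?_
        obtain ⟨v, rfl⟩ := e.toEquiv.surjective v
        simp [Iso.symm, Equiv.Set.congr]
      · have h₁ := C.vec_eq_of_iso (Iso.restrict e S.1 _ (key S.1))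
        have h₂ := C.vec_eq_of_iso (Iso.restrict e S.1ᶜ (e.toEquiv '' S.1)ᶜ fun v => by
          rw [Set.mem_compl_iff, Set.mem_compl_iff, ← key S.1])
        rw [h₁, h₂]
        rfl)

/-- The coefficient of `π₁ ⊗ π₂` in the coproduct of `π`. -/
noncomputable def coprodCoeff (π₁ π₂ π : C.Forest) : ℝ :=
  finsuppTensorFinsupp' ℝ C.Forest C.Forest (C.coprodForest π) (π₁, π₂)

theorem exists_rep (π : C.Forest) : ∃ G h, C.toForest G h = π :=
  Quotient.inductionOn π fun G => ⟨G.1, G.2, rfl⟩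

theorem exists_iso_of_vec_ne_zero {G H : Graph D} {hH : C.Mem H}
    (h : C.vec G (C.toForest H hH) ≠ 0) : Nonempty (Iso G H) := by
  classical
  by_cases hG : C.Mem G
  · rw [vec, dif_pos hG, Finsupp.single_apply] at h
    by_cases h' : C.toForest G hG = C.toForest H hH
    · exact Quotient.exact h'
    · exact absurd (if_neg h') h
  · rw [vec, dif_neg hG] at h
    exact absurd rfl h

open Classical in
theorem coprodCoeff_eq (π₁ π₂ : C.Forest) (G : Graph D) (hG : C.Mem G) :
    C.coprodCoeff π₁ π₂ (C.toForest G hG) = ∑ S : {S : Set G.V // G.IsClosed S},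
      C.vec (G.restrict S.1ᶜ) π₁ * C.vec (G.restrict S.1) π₂ := by
  have h : C.coprodForest (C.toForest G hG) = ∑ S : {S : Set G.V // G.IsClosed S},
      C.vec (G.restrict S.1ᶜ) ⊗ₜ[ℝ] C.vec (G.restrict S.1) := rfl
  rw [coprodCoeff, h, map_sum, Finsupp.finsetSum_apply]
  exact Finset.sum_congr rfl fun S _ => finsuppTensorFinsupp'_apply_apply _ _ _ _ _ _ _

/-- Only finitely many forests have `π₁ ⊗ π₂` in their coproduct. -/
theorem finite_support_coprodCoeff (π₁ π₂ : C.Forest) :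
    (Function.support (C.coprodCoeff π₁ π₂)).Finite := by
  classical
  obtain ⟨G₁, h₁, rfl⟩ := C.exists_rep π₁
  obtain ⟨G₂, h₂, rfl⟩ := C.exists_rep π₂
  let W := G₁.V ⊕ G₂.V
  let P := (W → Option W) × {m : W → W // ∀ v, m (m v) = v}
  let mkG : P → Graph D := fun p =>
    { V := W, next := p.1, dec := Sum.elim G₁.dec G₂.dec, mate := p.2.1, mate_mate := p.2.2 }
  let F : {p : P // C.Mem (mkG p)} → C.Forest := fun p => C.toForest (mkG p.1) p.2
  refine (Set.finite_range F).subset ?_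
  intro π hπ
  obtain ⟨G, hG, rfl⟩ := C.exists_rep π
  rw [Function.mem_support, coprodCoeff_eq] at hπ
  obtain ⟨S, -, hS⟩ := Finset.exists_ne_zero_of_sum_ne_zero hπ
  obtain ⟨e₁⟩ := C.exists_iso_of_vec_ne_zero (left_ne_zero_of_mul hS)
  obtain ⟨e₂⟩ := C.exists_iso_of_vec_ne_zero (right_ne_zero_of_mul hS)
  let E : G.V ≃ W :=
    ((Equiv.Set.sumCompl S.1).symm.trans (Equiv.sumComm _ _)).trans
      (Equiv.sumCongr e₁.toEquiv e₂.toEquiv)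
  have hE₁ : ∀ v (h : v ∈ S.1ᶜ), E v = Sum.inl (e₁.toEquiv ⟨v, h⟩) := by
    intro v h
    simp only [E, Equiv.trans_apply]
    rw [Equiv.Set.sumCompl_symm_apply_of_notMem h]
    rfl
  have hE₂ : ∀ v (h : v ∈ S.1), E v = Sum.inr (e₂.toEquiv ⟨v, h⟩) := by
    intro v h
    simp only [E, Equiv.trans_apply]
    rw [Equiv.Set.sumCompl_symm_apply_of_mem h]
    rfl
  let p : P := ⟨fun w => (G.next (E.symm w)).map E,
    ⟨fun w => E (G.mate (E.symm w)), fun w => by simp [G.mate_mate]⟩⟩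
  have iso : Iso G (mkG p) :=
    { toEquiv := E
      next_eq := fun v => by simp [mkG, p]
      dec_eq := fun v => by
        by_cases h : v ∈ S.1
        · rw [hE₂ v h]
          exact e₂.dec_eq ⟨v, h⟩
        · rw [hE₁ v h]
          exact e₁.dec_eq ⟨v, h⟩
      mate_eq := fun v => by simp [mkG, p] }
  exact ⟨⟨p, C.mem_of_iso iso hG⟩, Quotient.sound ⟨iso.symm⟩⟩

/-- The product of two forests which is dual to the coproduct: the coefficient of `π` in it is the
coefficient of `π₁ ⊗ π₂` in the coproduct of `π`. -/
noncomputable def ckForest (π₁ π₂ : C.Forest) : C.Space :=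
  Finsupp.ofSupportFinite (C.coprodCoeff π₁ π₂) (C.finite_support_coprodCoeff π₁ π₂)

/-- The bilinear extension of a product of forests. -/
noncomputable def extend (m : C.Forest → C.Forest → C.Space) :
    C.Space →ₗ[ℝ] C.Space →ₗ[ℝ] C.Space :=
  Finsupp.linearCombination ℝ fun π₁ => Finsupp.linearCombination ℝ fun π₂ => m π₁ π₂

/-- The grafting product. -/
noncomputable def graft : C.Space →ₗ[ℝ] C.Space →ₗ[ℝ] C.Space := C.extend C.graftForest

/-- The Grossman-Larson product. -/
noncomputable def gl : C.Space →ₗ[ℝ] C.Space →ₗ[ℝ] C.Space := C.extend C.glForest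

/-- The product dual to the Connes-Kreimer coproduct. -/
noncomputable def ck : C.Space →ₗ[ℝ] C.Space →ₗ[ℝ] C.Space := C.extend C.ckForest

end ForestClass

/-- A bilinear product with a unit is an associative unital algebra. -/
def IsUnitalAlgebra {M : Type*} [AddCommGroup M] [Module ℝ M] (mul : M →ₗ[ℝ] M →ₗ[ℝ] M)
    (one : M) : Prop :=
  (∀ x y z, mul (mul x y) z = mul x (mul y z)) ∧ (∀ x, mul one x = x) ∧ ∀ x, mul x one = x

/-- A linear map is an isomorphism of unital algebras from `(M, mul, one)` to
`(M', mul', one')`. -/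
def IsAlgebraIso {M M' : Type*} [AddCommGroup M] [Module ℝ M] [AddCommGroup M'] [Module ℝ M']
    (mul : M →ₗ[ℝ] M →ₗ[ℝ] M) (one : M) (mul' : M' →ₗ[ℝ] M' →ₗ[ℝ] M') (one' : M')
    (A : M →ₗ[ℝ] M') : Prop :=
  Function.Bijective A ∧ A one = one' ∧ ∀ x y, A (mul x y) = mul' (A x) (A y)

/-- For a class of forests: the Grossman-Larson product represents the composition of graftings,
both products are unital associative algebras, and the map multiplying every forest by its symmetry
coefficient is an isomorphism from the first algebra to the second. -/
def ForestClass.AsigmaIsAlgebraIso {D : Type u} (C : ForestClass D) : Prop :=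
  (∀ x y z : C.Space, C.graft x (C.graft y z) = C.graft (C.gl x y) z) ∧
    IsUnitalAlgebra C.gl C.one ∧ IsUnitalAlgebra C.ck C.one ∧
    IsAlgebraIso C.gl C.one C.ck C.one C.Asigma

end AromaticForest

namespace AromaticForest

variable {D : Type u}

/-! The comparison of the two products is a double count. Multiplying the coefficient of `G` in `G₁
◇ G₂` by `σ(G)` counts pairs of an attachment `f` and an isomorphism from the attached graph to `G`.
Multiplying the coefficient of `G₁ ⊗ G₂` in the coproduct of `G` by `σ(G₁)σ(G₂)` counts closed sets
`S` together with isomorphisms of the two induced parts with `G₁` and `G₂`. Both kinds of data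
amount to a bijection `G₁.V ⊕ G₂.V ≃ G.V` subject to the conditions `IsSplitting`
(`card_attach_iso`, `card_restrict_iso`), and this is the multiplicativity of `Asigma`. As `σ` never
vanishes, `Asigma` is bijective, and the algebra axioms for `⊛` are transported from those for `◇`.

Associativity of `◇` comes from a bijection between the two orders of iterated attachment
(`attachEquiv`) whose corresponding graphs are isomorphic (`attachAssoc`). Restricted to attachments
that leave no root free, the same bijection gives the identity between `↷` and `◇`.

The three classes are treated together: `IsLocal` says that membership is rootedness plus conditions
on single vertices and on ends of edges, which is all the argument uses. -/

theorem Graph.IsRooted.attach {G H : Graph D} (hG : G.IsRooted) (hH : H.IsRooted)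
    (f : G.Root → Option H.V) : (G.attach H f).IsRooted := by
  rcases hH with hH | ⟨w, hw⟩
  · rcases hG with hG | ⟨v, hv⟩
    · exact Or.inl inferInstance
    · refine Or.inr ⟨Sum.inl v, ?_⟩
      have : f ⟨v, hv⟩ = none := by
        cases h : f ⟨v, hv⟩ with
        | none => rfl
        | some w => exact hH.elim w
      simp [hv, this]
  · exact Or.inr ⟨Sum.inr w, by simp [hw]⟩

/-! ### Iterated attachment and its associativity. -/

theorem Graph.attach_next_root {G H : Graph D} (f : G.Root → Option H.V) {v : G.V}
    (hv : G.next v = none) :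
    (G.attach H f).next (Sum.inl v) = (f ⟨v, hv⟩).map Sum.inr := dif_pos hv

theorem Graph.attach_next_inl {G H : Graph D} (f : G.Root → Option H.V) {v u : G.V}
    (hv : G.next v = some u) : (G.attach H f).next (Sum.inl v) = some (Sum.inl u) := by
  simp [hv]

theorem Graph.attach_next_inr {G H : Graph D} (f : G.Root → Option H.V) (w : H.V) :
    (G.attach H f).next (Sum.inr w) = (H.next w).map Sum.inr := rfl

/-- The left side is a dependent sum because the roots available to the second attachment depend on
the first; bracketed the other way, the two choices are independent. -/
theorem sum_sum_eq_of_equiv {α γ δ M : Type*} {β : α → Type*} [AddCommMonoid M]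
    {_ : Fintype α} {_ : ∀ a, Fintype (β a)} {_ : Fintype γ} {_ : Fintype δ}
    (e : (Σ a, β a) ≃ γ × δ) (f : ∀ a, β a → M) (g : γ → δ → M)
    (h : ∀ a b, f a b = g (e ⟨a, b⟩).1 (e ⟨a, b⟩).2) :
    ∑ a, ∑ b, f a b = ∑ c, ∑ d, g c d := by
  rw [← Fintype.sum_sigma', ← Fintype.sum_prod_type']
  exact Fintype.sum_equiv e _ _ fun p => h p.1 p.2

/-- The functions which attach the roots of `G` to `H` and then the roots of the result to `K`
correspond to the functions which attach the roots of `H` to `K` and then the roots of `G` to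
the result. -/
noncomputable def attachEquiv (G H K : Graph D) :
    (Σ f : G.Root → Option H.V, (G.attach H f).Root → Option K.V) ≃
      (H.Root → Option K.V) × (G.Root → Option (H.V ⊕ K.V)) where
  toFun p := (fun w => p.2 ⟨Sum.inr w.1, by simp [w.2]⟩, fun r =>
    match h : p.1 r with
    | some w => some (Sum.inl w)
    | none => (p.2 ⟨Sum.inl r.1, by simp [r.2, h]⟩).map Sum.inr)
  invFun q := ⟨fun r => (q.2 r).bind Sum.getLeft?, fun x =>
    match x with
    -- The final `none` is never reached: a root of the attached graph that lies in `G` was already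
    -- a root of `G`.
    | ⟨Sum.inl v, _⟩ => if h : G.next v = none then (q.2 ⟨v, h⟩).bind Sum.getRight? else none
    | ⟨Sum.inr w, hw⟩ => q.1 ⟨w, by simpa using hw⟩⟩
  left_inv := by
    -- The type of `g` depends on `f`, so the second components are compared value by value, with
    -- independent proofs of being a root.
    have key : ∀ (f f' : G.Root → Option H.V) (g : (G.attach H f).Root → Option K.V)
        (g' : (G.attach H f').Root → Option K.V), f = f' →
        (∀ x h h', g ⟨x, h⟩ = g' ⟨x, h'⟩) →
        (⟨f, g⟩ : Σ f : G.Root → Option H.V, (G.attach H f).Root → Option K.V) = ⟨f', g'⟩ := by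
      rintro f _ g g' rfl h
      congr
      funext x
      exact h x.1 x.2 x.2
    rintro ⟨f, g⟩
    refine key _ _ _ _ ?_ ?_
    · funext r
      dsimp only
      split <;> rename_i h <;> simp only [h]
      · rfl
      · cases g ⟨Sum.inl r.1, _⟩ <;> rfl
    · rintro (v | w) h h'
      · have hv : G.next v = none := by
          by_contra hv
          obtain ⟨u, hu⟩ := Option.ne_none_iff_exists'.1 hv
          rw [Graph.attach_next_inl f hu] at h'
          cases h'
        have hf : f ⟨v, hv⟩ = none := by
          rw [Graph.attach_next_root f hv] at h'
          simpa using h'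
        dsimp only
        rw [dif_pos hv]
        split <;> rename_i h₂
        · rw [hf] at h₂; cases h₂
        · cases g ⟨Sum.inl v, _⟩ <;> rfl
      · rfl
  right_inv := by
    rintro ⟨g, f⟩
    refine Prod.ext rfl ?_
    funext r
    dsimp only
    split <;> rename_i h
    · revert h
      rcases f r with _ | (a | b) <;> simp [eq_comm]
    · rw [dif_pos r.2]
      revert h
      rcases f r with _ | (a | b) <;> simp

theorem attachEquiv_snd_some {G H K : Graph D} (f : G.Root → Option H.V)
    (g : (G.attach H f).Root → Option K.V) {r : G.Root} {w : H.V} (h : f r = some w) :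
    (attachEquiv G H K ⟨f, g⟩).2 r = some (Sum.inl w) := by
  dsimp only [attachEquiv, Equiv.coe_fn_mk]
  split <;> rename_i h₂ <;> simp_all

theorem attachEquiv_snd_none {G H K : Graph D} (f : G.Root → Option H.V)
    (g : (G.attach H f).Root → Option K.V) {r : G.Root} (h : f r = none) :
    (attachEquiv G H K ⟨f, g⟩).2 r =
      (g ⟨Sum.inl r.1, by simp [r.2, h]⟩).map Sum.inr := by
  dsimp only [attachEquiv, Equiv.coe_fn_mk]
  split <;> rename_i h₂
  · rw [h] at h₂; cases h₂
  · rfl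

/-- Attaching forests is associative. -/
noncomputable def attachAssoc (G H K : Graph D) (f : G.Root → Option H.V)
    (g : (G.attach H f).Root → Option K.V) :
    Iso ((G.attach H f).attach K g)
      (G.attach (H.attach K (attachEquiv G H K ⟨f, g⟩).1) (attachEquiv G H K ⟨f, g⟩).2) where
  toEquiv := Equiv.sumAssoc _ _ _
  next_eq := by
    rintro ((v | w) | z)
    · change (G.attach _ _).next (Sum.inl v) = _
      cases hv : G.next v with
      | some u =>
        rw [Graph.attach_next_inl _ hv, Graph.attach_next_inl _ (Graph.attach_next_inl f hv)]
        rfl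
      | none =>
        rw [Graph.attach_next_root _ hv]
        cases hf : f ⟨v, hv⟩ with
        | some w =>
          rw [attachEquiv_snd_some f g hf, Graph.attach_next_inl (u := Sum.inr w)]
          · rfl
          · rw [Graph.attach_next_root f hv, hf]; rfl
        | none =>
          have h₁ : (G.attach H f).next (Sum.inl v) = none := by
            rw [Graph.attach_next_root f hv, hf]; rfl
          rw [attachEquiv_snd_none f g hf, Graph.attach_next_root g h₁, Option.map_map,
            Option.map_map]
          rfl
    · change (G.attach (H.attach K _) _).next (Sum.inr (Sum.inl w)) = _
      rw [Graph.attach_next_inr]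
      cases hw : H.next w with
      | some u =>
        rw [Graph.attach_next_inl _ hw, Graph.attach_next_inl (u := Sum.inr u)]
        · rfl
        · rw [Graph.attach_next_inr, hw]; rfl
      | none =>
        have h₁ : (G.attach H f).next (Sum.inr w) = none := by
          rw [Graph.attach_next_inr, hw]; rfl
        rw [Graph.attach_next_root _ hw, Graph.attach_next_root g h₁, Option.map_map,
          Option.map_map]
        rfl
    · change (G.attach (H.attach K _) _).next (Sum.inr (Sum.inr z)) = _
      rw [Graph.attach_next_inr, Graph.attach_next_inr, Graph.attach_next_inr, Option.map_map,
        Option.map_map]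
      rfl
  dec_eq := by rintro ((v | w) | z) <;> rfl
  mate_eq := by rintro ((v | w) | z) <;> rfl

/-- A root of `G` sent into `H` is no longer a root when `g` is chosen; the fate of every other root
of `G` or `H` is decided by `g` alone. This is what specialises the associativity bijection to
grafting. -/
theorem attachEquiv_ne_none_iff (G H K : Graph D) (f : G.Root → Option H.V)
    (g : (G.attach H f).Root → Option K.V) :
    (∀ x, g x ≠ none) ↔ (∀ w, (attachEquiv G H K ⟨f, g⟩).1 w ≠ none) ∧
      ∀ r, (attachEquiv G H K ⟨f, g⟩).2 r ≠ none := by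
  constructor
  · refine fun h => ⟨fun w => h _, fun r => ?_⟩
    cases hf : f r with
    | some w => simp [attachEquiv_snd_some f g hf]
    | none => simpa [attachEquiv_snd_none f g hf] using h _
  · rintro ⟨h₁, h₂⟩ ⟨v | w, hx⟩
    · cases hv : G.next v with
      | some u => rw [Graph.attach_next_inl f hv] at hx; cases hx
      | none =>
        have hf : f ⟨v, hv⟩ = none := by
          rw [Graph.attach_next_root f hv] at hx
          simpa using hx
        simpa [attachEquiv_snd_none f g hf] using h₂ ⟨v, hv⟩
    · exact h₁ ⟨w, by simpa using hx⟩

/-- Attaching a forest to the empty one. -/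
noncomputable def attachEmpty (G : Graph D) (f : G.Root → Option (Graph.empty D).V) :
    Iso (G.attach (Graph.empty D) f) G where
  toEquiv := Equiv.sumEmpty G.V Empty
  next_eq := by
    rintro (v | v)
    · cases hv : G.next v with
      | some u =>
        rw [Graph.attach_next_inl _ hv]
        exact hv
      | none =>
        rw [Graph.attach_next_root _ hv]
        cases hf : f ⟨v, hv⟩ with
        | none => exact hv
        | some w => exact w.elim
    · exact v.elim
  dec_eq := by
    rintro (v | v)
    · rfl
    · exact v.elim
  mate_eq := by
    rintro (v | v)
    · rfl
    · exact v.elim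

/-- Attaching the empty forest. -/
noncomputable def emptyAttach (G : Graph D) (f : (Graph.empty D).Root → Option G.V) :
    Iso ((Graph.empty D).attach G f) G where
  toEquiv := Equiv.emptySum Empty G.V
  next_eq := by
    rintro (v | v)
    · exact v.elim
    · change G.next v = ((G.next v).map Sum.inr).map _
      rw [Option.map_map]
      exact Option.map_id'.symm ▸ rfl
  dec_eq := by
    rintro (v | v)
    · exact v.elim
    · rfl
  mate_eq := by
    rintro (v | v)
    · exact v.elim
    · rfl

/-! ### Local classes of forests; identities for grafting and the Grossman–Larson product. -/

namespace ForestClass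

/-- A class of forests given by a condition `P` on the decoration of a vertex and on whether the
vertex is unpaired, and a condition `Q` on the decoration of vertices with incoming edges. -/
structure IsLocal (C : ForestClass D) (P : D → Prop → Prop) (Q : D → Prop) : Prop where
  mem_iff : ∀ G, C.Mem G ↔ G.IsRooted ∧ (∀ v, P (G.dec v) (G.mate v = v)) ∧
    ∀ v u, G.next v = some u → Q (G.dec u)
  not_paired : ∀ d, P d True → ¬ P d False

variable {C : ForestClass D} {P : D → Prop → Prop} {Q : D → Prop}

theorem IsLocal.isRooted (hC : C.IsLocal P Q) {G : Graph D} (h : C.Mem G) : G.IsRooted :=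
  ((hC.mem_iff G).1 h).1

theorem IsLocal.mem_empty (hC : C.IsLocal P Q) : C.Mem (Graph.empty D) :=
  (hC.mem_iff _).2 ⟨Or.inl (inferInstanceAs (IsEmpty Empty)), fun v => v.elim, fun v => v.elim⟩

/-- The local conditions restrict to both parts, but rootedness does not: a lone loop has no root,
yet its union with a rooted graph does. Hence the two rootedness hypotheses. -/
theorem IsLocal.mem_of_attach (hC : C.IsLocal P Q) {G H : Graph D} (hG : G.IsRooted)
    (hH : H.IsRooted) {f : G.Root → Option H.V} (h : C.Mem (G.attach H f)) :
    C.Mem G ∧ C.Mem H := by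
  obtain ⟨-, h₁, h₂⟩ := (hC.mem_iff _).1 h
  refine ⟨(hC.mem_iff _).2 ⟨hG, fun v => ?_, fun v u hu => ?_⟩,
    (hC.mem_iff _).2 ⟨hH, fun v => ?_, fun v u hu => ?_⟩⟩
  · simpa using h₁ (Sum.inl v)
  · exact h₂ (Sum.inl v) (Sum.inl u) (Graph.attach_next_inl f hu)
  · simpa using h₁ (Sum.inr v)
  · exact h₂ (Sum.inr v) (Sum.inr u) (by rw [Graph.attach_next_inr, hu]; rfl)

/-- Restriction dissolves a split pair, so `v` would be unpaired in the part and paired in `G`, with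
the same decoration; `not_paired` forbids this. -/
theorem IsLocal.mate_mem (hC : C.IsLocal P Q) {G : Graph D} (hG : C.Mem G) {S : Set G.V}
    (hS : C.Mem (G.restrict S)) {v : G.V} (hv : v ∈ S) : G.mate v ∈ S := by
  by_contra hm
  have h₁ := ((hC.mem_iff _).1 hG).2.1 v
  have h₂ := ((hC.mem_iff _).1 hS).2.1 ⟨v, hv⟩
  have hne : G.mate v ≠ v := fun h => hm (h.symm ▸ hv)
  simp only [hm, dif_neg, not_false_eq_true] at h₂
  simp only [hne] at h₁
  exact hC.not_paired _ h₂ h₁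

theorem vec_of_mem (C : ForestClass D) {G : Graph D} (h : C.Mem G) :
    C.vec G = Finsupp.single (C.toForest G h) 1 := dif_pos h

theorem vec_of_not_mem (C : ForestClass D) {G : Graph D} (h : ¬ C.Mem G) : C.vec G = 0 :=
  dif_neg h

theorem extend_vec (C : ForestClass D) (m : C.Forest → C.Forest → C.Space) {G H : Graph D}
    (hG : C.Mem G) (hH : C.Mem H) :
    C.extend m (C.vec G) (C.vec H) = m (C.toForest G hG) (C.toForest H hH) := by
  simp [extend, vec_of_mem C hG, vec_of_mem C hH]

/-- Only rootedness is required, so the formula also applies to intermediate graphs that have left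
the class through a forbidden edge: by `mem_of_attach` both sides are then zero. The instance is
arbitrary so that it matches whichever one occurs in a goal. -/
theorem IsLocal.gl_vec (hC : C.IsLocal P Q) {G H : Graph D}
    [inst : Fintype (G.Root → Option H.V)] (hG : G.IsRooted) (hH : H.IsRooted) :
    C.gl (C.vec G) (C.vec H) = ∑ f : G.Root → Option H.V, C.vec (G.attach H f) := by
  classical
  obtain rfl : inst = Pi.instFintype := Subsingleton.elim _ _
  by_cases h : C.Mem G ∧ C.Mem H
  · exact C.extend_vec _ h.1 h.2
  · rw [Finset.sum_eq_zero fun f _ => C.vec_of_not_mem fun hf => h (hC.mem_of_attach hG hH hf)]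
    by_cases h₁ : C.Mem G
    · rw [C.vec_of_not_mem (G := H) fun h₂ => h ⟨h₁, h₂⟩, map_zero]
    · rw [C.vec_of_not_mem h₁, map_zero, LinearMap.zero_apply]

open Classical in
-- Grafting is written as a sum over partial attachments with an indicator of totality, so that
-- `attachEquiv` applies to it as it does to `◇`.
theorem IsLocal.graft_vec (hC : C.IsLocal P Q) {G H : Graph D}
    [inst : Fintype (G.Root → Option H.V)] (hG : G.IsRooted) (hH : H.IsRooted) :
    C.graft (C.vec G) (C.vec H) = ∑ f : G.Root → Option H.V,
      if ∀ r, f r ≠ none then C.vec (G.attach H f) else 0 := by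
  obtain rfl : inst = Pi.instFintype := Subsingleton.elim _ _
  have key : ∑ f : G.Root → H.V, C.vec (G.attach H fun r => some (f r)) =
      ∑ f : G.Root → Option H.V, if ∀ r, f r ≠ none then C.vec (G.attach H f) else 0 := by
    rw [← Finset.sum_filter]
    refine Finset.sum_bij (fun f _ r => some (f r)) ?_ ?_ ?_ ?_
    · simp
    · intro f _ f' _ h
      funext r
      exact Option.some_injective _ (congrFun h r)
    · intro f hf
      have hf' : ∀ r, ∃ w, f r = some w := fun r =>
        Option.ne_none_iff_exists'.1 ((Finset.mem_filter.1 hf).2 r)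
      choose g hg using hf'
      exact ⟨g, Finset.mem_univ _, funext fun r => (hg r).symm⟩
    · intros; rfl
  rw [← key]
  by_cases h : C.Mem G ∧ C.Mem H
  · exact C.extend_vec _ h.1 h.2
  · rw [Finset.sum_eq_zero fun f _ => C.vec_of_not_mem fun hf => h (hC.mem_of_attach hG hH hf)]
    by_cases h₁ : C.Mem G
    · rw [C.vec_of_not_mem (G := H) fun h₂ => h ⟨h₁, h₂⟩, map_zero]
    · rw [C.vec_of_not_mem h₁, map_zero, LinearMap.zero_apply]

/-- A linear statement on the span of the forests need only be checked on forests. -/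
theorem space_induction {p : C.Space → Prop} (zero : p 0)
    (add : ∀ x y, p x → p y → p (x + y)) (smul : ∀ (c : ℝ) x, p x → p (c • x))
    (vec : ∀ G, C.Mem G → p (C.vec G)) (x : C.Space) : p x := by
  induction x using Finsupp.induction_linear with
  | zero => exact zero
  | add x y hx hy => exact add x y hx hy
  | single π c =>
    obtain ⟨G, hG, rfl⟩ := C.exists_rep π
    have := smul c _ (vec G hG)
    rwa [C.vec_of_mem hG, Finsupp.smul_single, smul_eq_mul, mul_one] at this

theorem IsLocal.gl_assoc (hC : C.IsLocal P Q) (x y z : C.Space) :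
    C.gl (C.gl x y) z = C.gl x (C.gl y z) := by
  classical
  induction x using space_induction with
  | zero => simp
  | add x x' h h' => simp only [map_add, LinearMap.add_apply, h, h']
  | smul c x h => simp only [map_smul, LinearMap.smul_apply, h]
  | vec G hG =>
  induction y using space_induction with
  | zero => simp
  | add x x' h h' => simp only [map_add, LinearMap.add_apply, h, h']
  | smul c x h => simp only [map_smul, LinearMap.smul_apply, h]
  | vec H hH =>
  induction z using space_induction with
  | zero => simp
  | add x x' h h' => simp only [map_add, h, h']
  | smul c x h => simp only [map_smul, h]
  | vec K hK =>
  have rG := hC.isRooted hG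
  have rH := hC.isRooted hH
  have rK := hC.isRooted hK
  have h₁ : ∀ f : G.Root → Option H.V, C.gl (C.vec (G.attach H f)) (C.vec K) =
      ∑ g : (G.attach H f).Root → Option K.V, C.vec ((G.attach H f).attach K g) :=
    fun f => hC.gl_vec (rG.attach rH f) rK
  have h₂ : ∀ g : H.Root → Option K.V, C.gl (C.vec G) (C.vec (H.attach K g)) =
      ∑ f : G.Root → Option (H.V ⊕ K.V), C.vec (G.attach (H.attach K g) f) :=
    fun g => hC.gl_vec rG (rH.attach rK g)
  rw [hC.gl_vec rG rH, hC.gl_vec rH rK, map_sum, map_sum, LinearMap.sum_apply]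
  simp only [h₁, h₂]
  exact sum_sum_eq_of_equiv (attachEquiv G H K) _ _ fun f g =>
    C.vec_eq_of_iso (attachAssoc G H K f g)

theorem IsLocal.graft_graft (hC : C.IsLocal P Q) (x y z : C.Space) :
    C.graft x (C.graft y z) = C.graft (C.gl x y) z := by
  classical
  induction x using space_induction with
  | zero => simp
  | add x x' h h' => simp only [map_add, LinearMap.add_apply, h, h']
  | smul c x h => simp only [map_smul, LinearMap.smul_apply, h]
  | vec G hG =>
  induction y using space_induction with
  | zero => simp
  | add x x' h h' => simp only [map_add, LinearMap.add_apply, h, h']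
  | smul c x h => simp only [map_smul, LinearMap.smul_apply, h]
  | vec H hH =>
  induction z using space_induction with
  | zero => simp
  | add x x' h h' => simp only [map_add, h, h']
  | smul c x h => simp only [map_smul, h]
  | vec K hK =>
  have rG := hC.isRooted hG
  have rH := hC.isRooted hH
  have rK := hC.isRooted hK
  have h₁ : ∀ f : G.Root → Option H.V, C.graft (C.vec (G.attach H f)) (C.vec K) =
      ∑ g : (G.attach H f).Root → Option K.V,
        if ∀ x, g x ≠ none then C.vec ((G.attach H f).attach K g) else 0 :=
    fun f => hC.graft_vec (rG.attach rH f) rK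
  have h₂ : ∀ g : H.Root → Option K.V,
      C.graft (C.vec G) (if ∀ w, g w ≠ none then C.vec (H.attach K g) else 0) =
        ∑ f : G.Root → Option (H.V ⊕ K.V), if (∀ w, g w ≠ none) ∧ ∀ r, f r ≠ none then
          C.vec (G.attach (H.attach K g) f) else 0 := by
    intro g
    by_cases hg : ∀ w, g w ≠ none
    · rw [if_pos hg]
      refine (hC.graft_vec rG (rH.attach rK g)).trans ?_
      exact Finset.sum_congr rfl fun f _ => if_congr (and_iff_right hg).symm rfl rfl
    · rw [if_neg hg, map_zero]
      exact (Finset.sum_eq_zero fun f _ => if_neg fun h => hg h.1).symm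
  rw [hC.gl_vec rG rH, hC.graft_vec rH rK, map_sum, map_sum, LinearMap.sum_apply]
  simp only [h₁, h₂]
  refine (sum_sum_eq_of_equiv (attachEquiv G H K) _ _ fun f g => ?_).symm
  rw [C.vec_eq_of_iso (attachAssoc G H K f g)]
  exact if_congr (attachEquiv_ne_none_iff G H K f g) rfl rfl

theorem IsLocal.one_gl (hC : C.IsLocal P Q) (x : C.Space) : C.gl C.one x = x := by
  classical
  induction x using space_induction with
  | zero => simp
  | add x x' h h' => simp only [map_add, h, h']
  | smul c x h => simp only [map_smul, h]
  | vec G hG =>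
  have : IsEmpty (Graph.empty D).Root := ⟨fun r => r.1.elim⟩
  rw [one, hC.gl_vec (hC.isRooted hC.mem_empty) (hC.isRooted hG), Fintype.sum_unique]
  exact C.vec_eq_of_iso (emptyAttach G _)

theorem IsLocal.gl_one (hC : C.IsLocal P Q) (x : C.Space) : C.gl x C.one = x := by
  classical
  induction x using space_induction with
  | zero => simp
  | add x x' h h' => simp only [map_add, LinearMap.add_apply, h, h']
  | smul c x h => simp only [map_smul, LinearMap.smul_apply, h]
  | vec G hG =>
  have : IsEmpty (Graph.empty D).V := inferInstanceAs (IsEmpty Empty)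
  rw [one, hC.gl_vec (hC.isRooted hG) (hC.isRooted hC.mem_empty), Fintype.sum_unique]
  exact C.vec_eq_of_iso (attachEmpty G _)

end ForestClass

/-! ### Splittings, counted in two ways. -/

/-- The bijections from the vertices of `G₁` and `G₂` to those of `G` which identify `G` with the
result of attaching some roots of `G₁` to vertices of `G₂`. -/
structure IsSplitting {G₁ G₂ G : Graph D} (E : G₁.V ⊕ G₂.V ≃ G.V) : Prop where
  dec_eq : ∀ x, G.dec (E x) = Sum.elim G₁.dec G₂.dec x
  mate_eq : ∀ x, G.mate (E x) = E (Sum.map G₁.mate G₂.mate x)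
  next_inr : ∀ w, G.next (E (Sum.inr w)) = (G₂.next w).map (E ∘ Sum.inr)
  next_inl : ∀ v u, G₁.next v = some u → G.next (E (Sum.inl v)) = some (E (Sum.inl u))
  next_root : ∀ v u, G₁.next v = none → G.next (E (Sum.inl v)) ≠ some (E (Sum.inl u))

instance Iso.finite (G H : Graph D) : Finite (Iso G H) :=
  Finite.of_injective Iso.toEquiv fun e f h => by ext v; rw [h]

theorem Iso.isSplitting {G₁ G₂ G : Graph D} {f : G₁.Root → Option G₂.V}
    (e : Iso (G₁.attach G₂ f) G) : IsSplitting e.toEquiv where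
  dec_eq := e.dec_eq
  mate_eq := e.mate_eq
  next_inr w := by
    rw [e.next_eq, Graph.attach_next_inr, Option.map_map]
  next_inl v u h := by
    rw [e.next_eq, Graph.attach_next_inl f h]
    rfl
  next_root v u h := by
    rw [e.next_eq, Graph.attach_next_root f h]
    cases f ⟨v, h⟩ <;> simp

/-- Splittings are the same as isomorphisms from attached forests. -/
theorem card_attach_iso {G₁ G₂ G : Graph D} :
    Nat.card (Σ f : G₁.Root → Option G₂.V, Iso (G₁.attach G₂ f) G) =
      Nat.card {E : G₁.V ⊕ G₂.V ≃ G.V // IsSplitting E} := by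
  refine Nat.card_eq_of_bijective (fun p => ⟨p.2.toEquiv, p.2.isSplitting⟩) ⟨?_, ?_⟩
  · rintro ⟨f, e⟩ ⟨f', e'⟩ h
    have h : e.toEquiv = e'.toEquiv := congrArg Subtype.val h
    -- The bijection determines the attachment: `f r` is read off from the edge of `G` leaving the
    -- image of `r`.
    have hf : f = f' := by
      funext r
      have h₁ := e.next_eq (Sum.inl r.1)
      have h₂ := e'.next_eq (Sum.inl r.1)
      rw [← h, h₁, Graph.attach_next_root f r.2, Graph.attach_next_root f' r.2,
        (Option.map_injective e.toEquiv.injective).eq_iff,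
        (Option.map_injective Sum.inr_injective).eq_iff] at h₂
      exact h₂
    subst hf
    congr
    ext v
    rw [h]
  · rintro ⟨E, hE⟩
    -- By `next_root` the edge leaving the image of a root of `G₁` cannot end in the image of `G₁`,
    -- so `getRight?` discards nothing.
    refine ⟨⟨fun r => (G.next (E (Sum.inl r.1))).bind fun x => (E.symm x).getRight?,
      ⟨E, ?_, hE.dec_eq, hE.mate_eq⟩⟩, rfl⟩
    rintro (v | w)
    · cases hv : G₁.next v with
      | some u =>
        rw [Graph.attach_next_inl _ hv]
        exact hE.next_inl v u hv
      | none =>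
        rw [Graph.attach_next_root _ hv]
        cases hx : G.next (E (Sum.inl v)) with
        | none => simp
        | some x =>
          obtain ⟨u | w, rfl⟩ := E.surjective x
          · exact absurd hx (hE.next_root v u hv)
          · simp
    · rw [Graph.attach_next_inr, Option.map_map]
      exact hE.next_inr w

theorem Graph.restrict_next_some {G : Graph D} {S : Set G.V} {v w : G.V} (hv : v ∈ S)
    (hw : w ∈ S) (h : G.next v = some w) : (G.restrict S).next ⟨v, hv⟩ = some ⟨w, hw⟩ := by
  simp [h, hw]

theorem Graph.restrict_next_none {G : Graph D} {S : Set G.V} {v : G.V} (hv : v ∈ S)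
    (h : ∀ w ∈ S, G.next v ≠ some w) : (G.restrict S).next ⟨v, hv⟩ = none := by
  cases hw : G.next v with
  | none => simp [hw]
  | some w =>
    have : w ∉ S := fun h' => h w h' hw
    simp [hw, this]

theorem Graph.restrict_mate {G : Graph D} {S : Set G.V} {v : G.V} (hv : v ∈ S)
    (h : G.mate v ∈ S) : (G.restrict S).mate ⟨v, hv⟩ = ⟨G.mate v, h⟩ := by
  simp [h]

/-- The bijection of the vertices given by isomorphisms of the two parts of a graph. -/
noncomputable def glue {G₁ G₂ G : Graph D} (S : Set G.V) (e₁ : Iso (G.restrict Sᶜ) G₁)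
    (e₂ : Iso (G.restrict S) G₂) : G₁.V ⊕ G₂.V ≃ G.V := by
  classical exact ((Equiv.sumCongr e₁.toEquiv.symm e₂.toEquiv.symm).trans
    (Equiv.sumComm _ _)).trans (Equiv.Set.sumCompl S)

theorem glue_inl {G₁ G₂ G : Graph D} (S : Set G.V) (e₁ : Iso (G.restrict Sᶜ) G₁)
    (e₂ : Iso (G.restrict S) G₂) (x : (G.restrict Sᶜ).V) :
    glue S e₁ e₂ (Sum.inl (e₁.toEquiv x)) = x.1 := by
  simp [glue]

theorem glue_inr {G₁ G₂ G : Graph D} (S : Set G.V) (e₁ : Iso (G.restrict Sᶜ) G₁)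
    (e₂ : Iso (G.restrict S) G₂) (x : (G.restrict S).V) :
    glue S e₁ e₂ (Sum.inr (e₂.toEquiv x)) = x.1 := by
  simp [glue]

/-- Closedness keeps the edges starting in `S` inside `S`, and `hm` keeps pairs whole; without `hm`
the induced graphs would have forgotten the pairs that are split. -/
theorem glue_isSplitting {G₁ G₂ G : Graph D} {S : Set G.V} (hS : G.IsClosed S)
    (hm : ∀ v, v ∈ S → G.mate v ∈ S) (e₁ : Iso (G.restrict Sᶜ) G₁)
    (e₂ : Iso (G.restrict S) G₂) : IsSplitting (glue S e₁ e₂) where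
  dec_eq := by
    rintro (v | w)
    · obtain ⟨x, rfl⟩ := e₁.toEquiv.surjective v
      rw [glue_inl]
      exact (e₁.dec_eq x).symm
    · obtain ⟨x, rfl⟩ := e₂.toEquiv.surjective w
      rw [glue_inr]
      exact (e₂.dec_eq x).symm
  mate_eq := by
    rintro (v | w)
    · obtain ⟨⟨x, hx⟩, rfl⟩ := e₁.toEquiv.surjective v
      -- The complement is also stable under `mate`, because `mate` is an involution.
      have hx' : G.mate x ∈ Sᶜ := fun h => hx (by simpa [G.mate_mate] using hm _ h)
      rw [glue_inl, Sum.map_inl, e₁.mate_eq, glue_inl, Graph.restrict_mate hx hx']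
    · obtain ⟨⟨x, hx⟩, rfl⟩ := e₂.toEquiv.surjective w
      rw [glue_inr, Sum.map_inr, e₂.mate_eq, glue_inr, Graph.restrict_mate hx (hm x hx)]
  next_inr w := by
    obtain ⟨⟨x, hx⟩, rfl⟩ := e₂.toEquiv.surjective w
    rw [glue_inr, e₂.next_eq]
    cases h : G.next x with
    | none => rw [Graph.restrict_next_none hx (by simp [h])]; rfl
    | some y =>
      rw [Graph.restrict_next_some hx (hS x hx y h) h]
      exact congrArg some (glue_inr S e₁ e₂ ⟨y, _⟩).symm
  next_inl v u h := by
    obtain ⟨⟨x, hx⟩, rfl⟩ := e₁.toEquiv.surjective v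
    obtain ⟨⟨y, hy⟩, rfl⟩ := e₁.toEquiv.surjective u
    rw [glue_inl, glue_inl]
    rw [e₁.next_eq] at h
    by_contra hn
    obtain ⟨z, hz, hzy⟩ := Option.map_eq_some_iff.1 h
    obtain rfl := e₁.toEquiv.injective hzy
    by_cases h' : ∃ w ∈ Sᶜ, G.next x = some w
    · obtain ⟨w, hw, hxw⟩ := h'
      rw [Graph.restrict_next_some hx hw hxw] at hz
      cases hz
      exact hn hxw
    · push Not at h'
      rw [Graph.restrict_next_none hx h'] at hz
      cases hz
  next_root v u h := by
    obtain ⟨⟨x, hx⟩, rfl⟩ := e₁.toEquiv.surjective v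
    obtain ⟨⟨y, hy⟩, rfl⟩ := e₁.toEquiv.surjective u
    rw [glue_inl, glue_inl]
    intro h'
    rw [e₁.next_eq, Graph.restrict_next_some hx hy h'] at h
    cases h

/-- Recovers the closed set from the splitting, which gives injectivity in `card_restrict_iso`. -/
theorem range_glue_inr {G₁ G₂ G : Graph D} (S : Set G.V) (e₁ : Iso (G.restrict Sᶜ) G₁)
    (e₂ : Iso (G.restrict S) G₂) : Set.range (glue S e₁ e₂ ∘ Sum.inr) = S := by
  ext v
  constructor
  · rintro ⟨w, rfl⟩
    obtain ⟨x, rfl⟩ := e₂.toEquiv.surjective w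
    rw [Function.comp_apply, glue_inr]
    exact x.2
  · exact fun hv => ⟨e₂.toEquiv ⟨v, hv⟩, glue_inr S e₁ e₂ ⟨v, hv⟩⟩

namespace IsSplitting

variable {G₁ G₂ G : Graph D} {E : G₁.V ⊕ G₂.V ≃ G.V}

theorem isClosed (hE : IsSplitting E) : G.IsClosed (Set.range (E ∘ Sum.inr)) := by
  rintro _ ⟨v, rfl⟩ w hw
  rw [Function.comp_apply, hE.next_inr, Option.map_eq_some_iff] at hw
  obtain ⟨u, -, rfl⟩ := hw
  exact ⟨u, rfl⟩

theorem inl_mem (E : G₁.V ⊕ G₂.V ≃ G.V) (v : G₁.V) :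
    E (Sum.inl v) ∈ (Set.range (E ∘ Sum.inr))ᶜ := by
  rintro ⟨w, hw⟩
  cases E.injective hw

/-- The isomorphism of the first forest with the complement of the image of the second. -/
noncomputable def isoInl (hE : IsSplitting E) :
    Iso G₁ (G.restrict (Set.range (E ∘ Sum.inr))ᶜ) where
  toEquiv := Equiv.ofBijective (fun v => ⟨E (Sum.inl v), inl_mem E v⟩) (by
    constructor
    · intro v w h
      exact Sum.inl_injective (E.injective (congrArg Subtype.val h))
    · rintro ⟨x, hx⟩
      obtain ⟨v | w, rfl⟩ := E.surjective x
      · exact ⟨v, rfl⟩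
      · exact absurd ⟨w, rfl⟩ hx)
  next_eq v := by
    cases h : G₁.next v with
    | some u => exact Graph.restrict_next_some _ _ (hE.next_inl v u h)
    | none =>
      refine Graph.restrict_next_none _ fun x hx => ?_
      obtain ⟨u | w, rfl⟩ := E.surjective x
      · exact hE.next_root v u h
      · exact absurd ⟨w, rfl⟩ hx
  dec_eq v := hE.dec_eq (Sum.inl v)
  mate_eq v := by
    have h : G.mate (E (Sum.inl v)) = E (Sum.inl (G₁.mate v)) := hE.mate_eq (Sum.inl v)
    refine (Graph.restrict_mate (inl_mem E v) (h ▸ inl_mem E _)).trans (Subtype.ext h)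

/-- The isomorphism of the second forest with its image. -/
noncomputable def isoInr (hE : IsSplitting E) :
    Iso G₂ (G.restrict (Set.range (E ∘ Sum.inr))) where
  toEquiv := Equiv.ofInjective (E ∘ Sum.inr) (E.injective.comp Sum.inr_injective)
  next_eq v := by
    have h' := hE.next_inr v
    cases h : G₂.next v with
    | some u =>
      rw [h] at h'
      exact Graph.restrict_next_some _ _ h'
    | none =>
      rw [h] at h'
      exact Graph.restrict_next_none (G := G) (Set.mem_range_self v) fun x hx => by
        rw [Function.comp_apply, h']; exact Option.some_ne_none x |>.symm
  dec_eq v := hE.dec_eq (Sum.inr v)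
  mate_eq v := by
    have h : G.mate (E (Sum.inr v)) = E (Sum.inr (G₂.mate v)) := hE.mate_eq (Sum.inr v)
    refine (Graph.restrict_mate (Set.mem_range_self v) (h ▸ Set.mem_range_self _)).trans (Subtype.ext h)

end IsSplitting

/-- Splittings are the same as closed subsets with isomorphisms of the two parts. -/
theorem card_restrict_iso {G₁ G₂ G : Graph D}
    (hm : ∀ S : Set G.V, Nonempty (Iso (G.restrict S) G₂) → ∀ v ∈ S, G.mate v ∈ S) :
    Nat.card (Σ S : {S : Set G.V // G.IsClosed S},
      Iso (G.restrict S.1ᶜ) G₁ × Iso (G.restrict S.1) G₂) =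
      Nat.card {E : G₁.V ⊕ G₂.V ≃ G.V // IsSplitting E} := by
  refine Nat.card_eq_of_bijective (fun p => ⟨glue p.1.1 p.2.1 p.2.2,
    glue_isSplitting p.1.2 (hm _ ⟨p.2.2⟩) p.2.1 p.2.2⟩) ⟨?_, ?_⟩
  · rintro ⟨⟨S, hS⟩, e₁, e₂⟩ ⟨⟨T, hT⟩, e₁', e₂'⟩ h
    have h : glue S e₁ e₂ = glue T e₁' e₂' := congrArg Subtype.val h
    have hST : S = T := by
      rw [← range_glue_inr S e₁ e₂, h, range_glue_inr]
    subst hST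
    have h₁ : e₁ = e₁' := by
      ext v
      refine Sum.inl_injective ((glue S e₁ e₂).injective ?_)
      rw [glue_inl, h, glue_inl]
    have h₂ : e₂ = e₂' := by
      ext v
      refine Sum.inr_injective ((glue S e₁ e₂).injective ?_)
      rw [glue_inr, h, glue_inr]
    rw [h₁, h₂]
  · rintro ⟨E, hE⟩
    refine ⟨⟨⟨_, hE.isClosed⟩, hE.isoInl.symm, hE.isoInr.symm⟩, Subtype.ext (Equiv.ext ?_)⟩
    rintro (v | w)
    · have := glue_inl _ hE.isoInl.symm hE.isoInr.symm (hE.isoInl.toEquiv v)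
      rwa [show hE.isoInl.symm.toEquiv (hE.isoInl.toEquiv v) = v from
        hE.isoInl.toEquiv.symm_apply_apply v] at this
    · have := glue_inr _ hE.isoInl.symm hE.isoInr.symm (hE.isoInr.toEquiv w)
      rwa [show hE.isoInr.symm.toEquiv (hE.isoInr.toEquiv w) = w from
        hE.isoInr.toEquiv.symm_apply_apply w] at this

/-! ### Symmetry coefficients and the isomorphism of algebras. -/

namespace ForestClass

variable {C : ForestClass D} {P : D → Prop → Prop} {Q : D → Prop}

/-- The number of isomorphisms of two graphs is `0` or the order of the automorphism group. -/
theorem vec_mul_sigma {G H : Graph D} (hH : C.Mem H) :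
    C.vec G (C.toForest H hH) * H.sigma = Nat.card (Iso G H) := by
  classical
  by_cases h : Nonempty (Iso G H)
  · obtain ⟨e⟩ := h
    have hc : Nat.card (Iso G H) = H.sigma := Nat.card_congr
      { toFun := fun f => e.symm.trans f
        invFun := fun f => e.trans f
        left_inv := fun f => by ext v; simp [Iso.trans, Iso.symm]
        right_inv := fun f => by ext v; simp [Iso.trans, Iso.symm] }
    rw [hc, C.vec_eq_of_iso e, C.vec_of_mem hH, Finsupp.single_eq_same, one_mul]
  · have h0 : C.vec G (C.toForest H hH) = 0 := by
      by_contra hne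
      exact h (C.exists_iso_of_vec_ne_zero hne)
    rw [not_nonempty_iff] at h
    simp [h0]

theorem sigma_toForest {G : Graph D} (hG : C.Mem G) : C.sigma (C.toForest G hG) = G.sigma := rfl

theorem sigma_ne_zero (π : C.Forest) : (C.sigma π : ℝ) ≠ 0 := by
  obtain ⟨G, hG, rfl⟩ := C.exists_rep π
  have : Nonempty (Iso G G) := ⟨Iso.refl G⟩
  rw [sigma_toForest, Nat.cast_ne_zero]
  exact Nat.card_pos.ne'

theorem Asigma_apply (x : C.Space) (π : C.Forest) : C.Asigma x π = C.sigma π * x π := by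
  classical
  induction x using Finsupp.induction_linear with
  | zero => simp
  | add x y hx hy => rw [map_add, Finsupp.add_apply, hx, hy, Finsupp.add_apply, mul_add]
  | single ρ c =>
    by_cases h : ρ = π
    · subst h
      simp [Asigma, mul_comm]
    · simp [Asigma, h]

theorem Asigma_vec {G : Graph D} (hG : C.Mem G) :
    C.Asigma (C.vec G) = (G.sigma : ℝ) • C.vec G := by
  simp [Asigma, C.vec_of_mem hG, sigma_toForest]

theorem Asigma_bijective (C : ForestClass D) : Function.Bijective C.Asigma := by
  constructor
  · intro x y h
    ext π
    have := DFunLike.congr_fun h π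
    rw [Asigma_apply, Asigma_apply] at this
    exact mul_left_cancel₀ (sigma_ne_zero π) this
  · intro y
    -- The preimage is `y` with each coefficient divided by the symmetry coefficient; its support
    -- lies in that of `y`.
    refine ⟨Finsupp.ofSupportFinite (fun π => (C.sigma π : ℝ)⁻¹ * y π)
      (y.hasFiniteSupport.subset fun π hπ => right_ne_zero_of_mul hπ), ?_⟩
    ext π
    rw [Asigma_apply]
    exact mul_inv_cancel_left₀ (sigma_ne_zero π) _

theorem IsLocal.Asigma_one (hC : C.IsLocal P Q) : C.Asigma C.one = C.one := by
  have : Nat.card (Iso (Graph.empty D) (Graph.empty D)) = 1 :=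
    Nat.card_eq_one_iff_unique.2 ⟨⟨fun e f => Iso.ext' fun v => v.elim⟩, ⟨Iso.refl _⟩⟩
  rw [one, Asigma_vec hC.mem_empty, Graph.sigma, this, Nat.cast_one, one_smul]

/-- The factor `σ(G)` turns the indicator that the attached graph is isomorphic to `G` into the
number of such isomorphisms. -/
theorem IsLocal.Asigma_gl_apply (hC : C.IsLocal P Q) {G₁ G₂ G : Graph D} (h₁ : C.Mem G₁)
    (h₂ : C.Mem G₂) (h : C.Mem G) :
    C.Asigma (C.gl (C.vec G₁) (C.vec G₂)) (C.toForest G h) =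
      Nat.card {E : G₁.V ⊕ G₂.V ≃ G.V // IsSplitting E} := by
  classical
  rw [Asigma_apply, hC.gl_vec (hC.isRooted h₁) (hC.isRooted h₂), Finsupp.finsetSum_apply,
    Finset.mul_sum, ← card_attach_iso, Nat.card_sigma, Nat.cast_sum]
  refine Finset.sum_congr rfl fun f _ => ?_
  rw [mul_comm, sigma_toForest, vec_mul_sigma]

/-- Here `σ(G₁)` and `σ(G₂)` turn the two indicators in each coproduct term into numbers of
isomorphisms. Membership of `G` and `G₂` ensures that no contributing set splits a pair. -/
theorem IsLocal.ck_Asigma_apply (hC : C.IsLocal P Q) {G₁ G₂ G : Graph D} (h₁ : C.Mem G₁)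
    (h₂ : C.Mem G₂) (h : C.Mem G) :
    C.ck (C.Asigma (C.vec G₁)) (C.Asigma (C.vec G₂)) (C.toForest G h) =
      Nat.card {E : G₁.V ⊕ G₂.V ≃ G.V // IsSplitting E} := by
  classical
  have hck : C.ck (C.vec G₁) (C.vec G₂) (C.toForest G h) =
      C.coprodCoeff (C.toForest G₁ h₁) (C.toForest G₂ h₂) (C.toForest G h) := by
    rw [ck, C.extend_vec _ h₁ h₂]
    rfl
  have hm : ∀ S : Set G.V, Nonempty (Iso (G.restrict S) G₂) → ∀ v ∈ S, G.mate v ∈ S :=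
    fun S ⟨e⟩ v hv => hC.mate_mem h (C.mem_of_iso e.symm h₂) hv
  rw [Asigma_vec h₁, Asigma_vec h₂, map_smul, map_smul, LinearMap.smul_apply,
    Finsupp.smul_apply, Finsupp.smul_apply, smul_eq_mul, smul_eq_mul, hck, coprodCoeff_eq,
    Finset.mul_sum, Finset.mul_sum, ← card_restrict_iso hm, Nat.card_sigma, Nat.cast_sum]
  refine Finset.sum_congr rfl fun S _ => ?_
  rw [Nat.card_prod, Nat.cast_mul, ← vec_mul_sigma h₁, ← vec_mul_sigma h₂]
  ring

theorem IsLocal.Asigma_gl (hC : C.IsLocal P Q) (x y : C.Space) :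
    C.Asigma (C.gl x y) = C.ck (C.Asigma x) (C.Asigma y) := by
  induction x using space_induction with
  | zero => simp
  | add x x' h h' => simp only [map_add, LinearMap.add_apply, h, h']
  | smul c x h => simp only [map_smul, LinearMap.smul_apply, h]
  | vec G hG =>
  induction y using space_induction with
  | zero => simp
  | add x x' h h' => simp only [map_add, h, h']
  | smul c x h => simp only [map_smul, h]
  | vec H hH =>
  ext π
  obtain ⟨K, hK, rfl⟩ := C.exists_rep π
  rw [hC.Asigma_gl_apply hG hH, hC.ck_Asigma_apply hG hH]

theorem IsLocal.asigmaIsAlgebraIso (hC : C.IsLocal P Q) : C.AsigmaIsAlgebraIso := by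
  refine ⟨hC.graft_graft, ⟨hC.gl_assoc, hC.one_gl, hC.gl_one⟩, ⟨fun x y z => ?_, fun x => ?_,
    fun x => ?_⟩, C.Asigma_bijective, hC.Asigma_one, hC.Asigma_gl⟩
  · obtain ⟨x, rfl⟩ := C.Asigma_bijective.2 x
    obtain ⟨y, rfl⟩ := C.Asigma_bijective.2 y
    obtain ⟨z, rfl⟩ := C.Asigma_bijective.2 z
    simp only [← hC.Asigma_gl, hC.gl_assoc]
  · obtain ⟨x, rfl⟩ := C.Asigma_bijective.2 x
    rw [← hC.Asigma_one, ← hC.Asigma_gl, hC.one_gl]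
  · obtain ⟨x, rfl⟩ := C.Asigma_bijective.2 x
    rw [← hC.Asigma_one, ← hC.Asigma_gl, hC.gl_one]

end ForestClass

/-! ### The three classes are local. -/

theorem aromatic_isLocal (D : Type u) :
    (aromatic D).IsLocal (fun _ p => p) (fun _ => True) where
  mem_iff G := by simp [aromatic]
  not_paired := by simp

theorem grafted_isLocal : grafted.IsLocal (fun _ p => p) (fun d => d = Color.black) where
  mem_iff G := Iff.rfl
  not_paired := by simp

/-- The colour dictates whether a vertex is paired: `P d True` forces `d` black, `P d False` forces
it not black. This incompatibility is what `not_paired` asks for. -/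
theorem exotic_isLocal :
    exotic.IsLocal (fun d p => p ↔ d = Color.black) (fun d => d = Color.black) where
  mem_iff G := Iff.rfl
  not_paired := by simp

end AromaticForest

theorem mainTheorem2 :
    (∀ D : Type u, (AromaticForest.aromatic D).AsigmaIsAlgebraIso) ∧
      AromaticForest.grafted.AsigmaIsAlgebraIso ∧
      AromaticForest.exotic.AsigmaIsAlgebraIso :=
  ⟨fun D => (AromaticForest.aromatic_isLocal D).asigmaIsAlgebraIso,
    AromaticForest.grafted_isLocal.asigmaIsAlgebraIso,
    AromaticForest.exotic_isLocal.asigmaIsAlgebraIso⟩
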